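/- Let $\alpha\in(0,1)\cup(1,2)$. For $m\ge 1$, an $m$-point Gauss–Radau–Jacobi quadrature with endpoint $t_m=1$ consists of real nodes $t_1<\dots<t_m=1$ and real weights $w_1,\dots,w_m$ such that $$\int_0^1 p(t)\,t^{\alpha-1}(1-t)^{1-\alpha}\,dt=\sum_{i=1}^m w_i\,p(t_i)$$ for every real polynomial $p$ of degree at most $2m-2$. For every $m\ge1$ such a quadrature exists, and for each one $t_i\in(0,1]$ and $w_i>0$ for all $i$. Let moreover $H$ be a finite-dimensional complex Hilbert space and let $\rho,\sigma$ be positive semidefinite operators on $H$ with $\rho\ll\sigma$, i.e. $\ker\sigma\subseteq\ker\rho$ (negative powers of $\sigma$ are taken on its support). For $m\geq 1$ and an $m$-point quadrature as above put $$B_m:=C_m+\frac{\sin(\alpha\pi)}{\pi}\sum_{i=1}^m\frac{w_i}{t_i}\,\inf_Z\Big(\operatorname{Tr}\big[\rho\,(Z+Z^\dagger+(1-t_i)Z^\dagger Z)\big]+t_i\operatorname{Tr}\big[\sigma ZZ^\dagger\big]\Big),$$ $$C_m:=\operatorname{Tr}[\rho]\Big(1+\frac{\sin(\alpha\pi)}{\pi}\sum_{i=1}^m\frac{w_i}{t_i}\Big),$$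 where each infimum is over all linear operators $Z$ on $H$. All these infima are finite. If $\alpha\in(0,1)$, then $\operatorname{Tr}[\rho^\alpha\sigma^{1-\alpha}]\ge B_m$ for every $m\ge1$; if $\alpha\in(1,2)$, then $\operatorname{Tr}[\rho^\alpha\sigma^{1-\alpha}]\le B_m$ for every $m\ge1$. In both cases $B_m\to\operatorname{Tr}[\rho^\alpha\sigma^{1-\alpha}]$ as $m\to\infty$. -/

import Mathlib

open MeasureTheory Filter Topology

noncomputable section

namespace PetzRenyi

/-- The Jacobi-type weight `t ^ (α - 1) * (1 - t) ^ (1 - α)` on `[0, 1]`. -/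
def jacobiWeight (α t : ℝ) : ℝ :=
  t ^ (α - 1) * (1 - t) ^ (1 - α)

/-- The nodes `t` (listed in increasing order) and the weights `w` form an `m`-point
Gauss-Radau-Jacobi quadrature rule with prescribed node `1` for the weight function
`t ^ (α - 1) * (1 - t) ^ (1 - α)` on `[0, 1]`: the last node is `1`, and the rule integrates every
real polynomial of degree at most `2 * m - 2` exactly. -/
structure IsGaussRadauJacobi (α : ℝ) (m : ℕ) (t w : Fin m → ℝ) : Prop where
  strictMono : StrictMono t
  last_node : ∀ i : Fin m, (i : ℕ) + 1 = m → t i = 1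
  exact : ∀ p : Polynomial ℝ, p.natDegree + 2 ≤ 2 * m →
    ∫ s in (0 : ℝ)..1, p.eval s * jacobiWeight α s = ∑ i, w i * p.eval (t i)

section Operators

variable {H : Type*} [NormedAddCommGroup H] [InnerProductSpace ℂ H] [CompleteSpace H]

/-- The (real part of the) trace of an operator. It is used only for operators whose trace is
real. -/
def tr (A : H →L[ℂ] H) : ℝ :=
  (LinearMap.trace ℂ H (A : H →ₗ[ℂ] H)).re

/-- `ρ ≪ σ`, that is, `ker σ ⊆ ker ρ`. -/
def Dominated (ρ σ : H →L[ℂ] H) : Prop :=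
  ∀ v : H, σ v = 0 → ρ v = 0

/-- `Tr[ρ ^ α * σ ^ (1 - α)]`. Powers of positive semidefinite operators are taken by the functional
calculus, with `0 ^ s = 0` for every real `s ≠ 0`; so negative powers are those of the
pseudo-inverse, that is, they are taken on the support. -/
def petzTrace (α : ℝ) (ρ σ : H →L[ℂ] H) : ℝ :=
  tr (ρ ^ α * σ ^ (1 - α))

/-- The objective function `Tr[ρ (Z + Z† + (1 - t) Z† Z)] + t Tr[σ Z Z†]`. -/
def objective (ρ σ : H →L[ℂ] H) (t : ℝ) (Z : H →L[ℂ] H) : ℝ :=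
  tr (ρ * (Z + star Z + ((1 - t : ℝ) : ℂ) • (star Z * Z))) + t * tr (σ * (Z * star Z))

/-- The variational bound generated by the nodes `t` and the weights `w`, including the constant
`C = Tr[ρ] (1 + (sin (α π) / π) ∑ i, w i / t i)`. -/
def quadratureBound (α : ℝ) {m : ℕ} (t w : Fin m → ℝ) (ρ σ : H →L[ℂ] H) : ℝ :=
  tr ρ * (1 + Real.sin (α * Real.pi) / Real.pi * ∑ i, w i / t i)
    + Real.sin (α * Real.pi) / Real.pi *
        ∑ i, w i / t i * ⨅ Z : H →L[ℂ] H, objective ρ σ (t i) Z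

end Operators

end PetzRenyi

end

/-!
The case `r, s > 0` of scalars comes first: Euler's beta integral gives
`r ^ α * s ^ (1 - α) = r + sin (α π) / π * ∫ t, r (s - r) / (s t + r (1 - t))` against the Jacobi
weight. The integrand is a multiple of `(t - c)⁻¹` with pole `c = r / (r - s)` outside `[0, 1]`. The
polynomial that interpolates it once at the node `1` and doubly at the other nodes lies below it on
`[0, 1]` and is integrated exactly, so every quadrature underestimates the integral; the sign of
`sin (α π)` decides on which side of `r ^ α * s ^ (1 - α)` the bound lies. Convergence is the
Weierstrass approximation theorem together with positivity of the weights.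

For operators, the matrix entries of `Z` in eigenbases of `ρ` and `σ` decouple the objective.
Completing the square in each entry evaluates the infimum, and both the trace and the bound become
sums of the scalar quantities over pairs of eigenvalues, weighted by the squared overlaps of the
eigenvectors. Domination restricts the sums to pairs of positive eigenvalues.
-/

namespace PetzRenyi

section BetaIntegral

open ProbabilityTheory (beta)

theorem ofReal_betaIntegrand (a b : ℝ) {t : ℝ} (ht : t ∈ Set.Ioo (0 : ℝ) 1) :
    ((t ^ (a - 1) * (1 - t) ^ (b - 1) : ℝ) : ℂ) =
      (t : ℂ) ^ ((a : ℂ) - 1) * (1 - (t : ℂ)) ^ ((b : ℂ) - 1) := by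
  rw [Complex.ofReal_mul, Complex.ofReal_cpow ht.1.le, Complex.ofReal_cpow (sub_pos.2 ht.2).le]
  push_cast
  rfl

theorem intervalIntegrable_betaIntegrand {a b : ℝ} (ha : 0 < a) (hb : 0 < b) :
    IntervalIntegrable (fun t : ℝ => t ^ (a - 1) * (1 - t) ^ (b - 1)) volume 0 1 := by
  have h := Complex.betaIntegral_convergent (u := (a : ℂ)) (v := (b : ℂ)) (by simpa) (by simpa)
  rw [intervalIntegrable_iff_integrableOn_Ioo_of_le zero_le_one] at h ⊢
  exact (h.congr_fun (fun t ht => (ofReal_betaIntegrand a b ht).symm) measurableSet_Ioo).re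

theorem integral_betaIntegrand {a b : ℝ} (ha : 0 < a) (hb : 0 < b) :
    ∫ t in (0 : ℝ)..1, t ^ (a - 1) * (1 - t) ^ (b - 1) = beta a b := by
  rw [ProbabilityTheory.beta_eq_betaIntegralReal a b ha hb, Complex.betaIntegral,
    ← intervalIntegral.integral_congr_Ioo_of_le zero_le_one
      fun t ht => ofReal_betaIntegrand a b ht,
    intervalIntegral.integral_ofReal, Complex.ofReal_re]

theorem beta_one_sub (a : ℝ) : beta a (1 - a) = Real.pi / Real.sin (a * Real.pi) := by
  rw [beta, add_sub_cancel, Real.Gamma_one, div_one, Real.Gamma_mul_Gamma_one_sub,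
    mul_comm Real.pi]

/-- The Möbius transformation of `[0, 1]` that fixes both endpoints and has derivative `y / x`
at `0`. Substituting it removes the denominator of the Feynman integral
`integral_betaIntegrand_div_rpow`. -/
noncomputable def unitMoebius (x y u : ℝ) : ℝ :=
  y * u / (x * (1 - u) + y * u)

theorem segment_pos {x y u : ℝ} (hx : 0 < x) (hy : 0 < y) (hu : u ∈ Set.Icc (0 : ℝ) 1) :
    0 < x * (1 - u) + y * u := by
  nlinarith [min_le_left x y, min_le_right x y, lt_min hx hy, hu.1, hu.2]

variable {x y u : ℝ}

theorem one_sub_unitMoebius (hx : 0 < x) (hy : 0 < y) (hu : u ∈ Set.Ioo (0 : ℝ) 1) :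
    1 - unitMoebius x y u = x * (1 - u) / (x * (1 - u) + y * u) := by
  have := (segment_pos hx hy (Set.Ioo_subset_Icc_self hu)).ne'
  rw [unitMoebius]
  field_simp
  ring

theorem unitMoebius_mem_Ioo (hx : 0 < x) (hy : 0 < y) (hu : u ∈ Set.Ioo (0 : ℝ) 1) :
    unitMoebius x y u ∈ Set.Ioo (0 : ℝ) 1 := by
  have hE := segment_pos hx hy (Set.Ioo_subset_Icc_self hu)
  refine ⟨div_pos (mul_pos hy hu.1) hE, sub_pos.1 ?_⟩
  rw [one_sub_unitMoebius hx hy hu]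
  exact div_pos (mul_pos hx (sub_pos.2 hu.2)) hE

theorem unitMoebius_swap_unitMoebius (hx : 0 < x) (hy : 0 < y) (hu : u ∈ Set.Ioo (0 : ℝ) 1) :
    unitMoebius y x (unitMoebius x y u) = u := by
  have hE := (segment_pos hx hy (Set.Ioo_subset_Icc_self hu)).ne'
  rw [unitMoebius, one_sub_unitMoebius hx hy hu, unitMoebius]
  field_simp
  ring

theorem image_unitMoebius (hx : 0 < x) (hy : 0 < y) :
    unitMoebius x y '' Set.Ioo 0 1 = Set.Ioo 0 1 :=
  Set.BijOn.image_eq <| Set.InvOn.bijOn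
    ⟨fun _ => unitMoebius_swap_unitMoebius hx hy, fun _ => unitMoebius_swap_unitMoebius hy hx⟩
    (fun _ => unitMoebius_mem_Ioo hx hy) (fun _ => unitMoebius_mem_Ioo hy hx)

theorem injOn_unitMoebius (hx : 0 < x) (hy : 0 < y) :
    Set.InjOn (unitMoebius x y) (Set.Ioo 0 1) :=
  Set.LeftInvOn.injOn fun _ => unitMoebius_swap_unitMoebius hx hy

theorem hasDerivAt_unitMoebius (hx : 0 < x) (hy : 0 < y) (hu : u ∈ Set.Ioo (0 : ℝ) 1) :
    HasDerivAt (unitMoebius x y) (x * y / (x * (1 - u) + y * u) ^ 2) u := by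
  have h_num : HasDerivAt (fun u : ℝ => y * u) y u := by
    simpa using (hasDerivAt_id u).const_mul y
  have h_den : HasDerivAt (fun u : ℝ => x * (1 - u) + y * u) (x * (-1) + y) u :=
    (((hasDerivAt_id u).const_sub 1).const_mul x).add h_num
  refine (h_num.div h_den (segment_pos hx hy (Set.Ioo_subset_Icc_self hu)).ne').congr_deriv ?_
  congr 1
  ring

theorem integral_comp_unitMoebius (hx : 0 < x) (hy : 0 < y) (g : ℝ → ℝ) :
    ∫ u in (0 : ℝ)..1, x * y / (x * (1 - u) + y * u) ^ 2 * g (unitMoebius x y u) =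
      ∫ t in (0 : ℝ)..1, g t := by
  simp only [intervalIntegral.integral_of_le zero_le_one, integral_Ioc_eq_integral_Ioo]
  conv_rhs => rw [← image_unitMoebius hx hy]
  rw [integral_image_eq_integral_abs_deriv_smul measurableSet_Ioo
    (fun u hu => (hasDerivAt_unitMoebius hx hy hu).hasDerivWithinAt) (injOn_unitMoebius hx hy)]
  refine setIntegral_congr_fun measurableSet_Ioo fun u _ => ?_
  rw [abs_of_nonneg (by positivity), smul_eq_mul]

theorem betaIntegrand_div_rpow_unitMoebius (a b : ℝ) (hx : 0 < x) (hy : 0 < y)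
    (hu : u ∈ Set.Ioo (0 : ℝ) 1) :
    x * y / (x * (1 - u) + y * u) ^ 2 *
        (unitMoebius x y u ^ (a - 1) * (1 - unitMoebius x y u) ^ (b - 1) /
          (x * unitMoebius x y u + y * (1 - unitMoebius x y u)) ^ (a + b)) =
      x ^ (-a) * y ^ (-b) * (u ^ (a - 1) * (1 - u) ^ (b - 1)) := by
  have hE := segment_pos hx hy (Set.Ioo_subset_Icc_self hu)
  have hu1 : 0 < 1 - u := sub_pos.2 hu.2
  have h_den : x * unitMoebius x y u + y * (1 - unitMoebius x y u) =
      x * y / (x * (1 - u) + y * u) := by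
    rw [one_sub_unitMoebius hx hy hu, unitMoebius]
    field_simp
    ring
  rw [h_den, one_sub_unitMoebius hx hy hu, unitMoebius]
  generalize x * (1 - u) + y * u = E at hE
  rw [Real.div_rpow (mul_pos hy hu.1).le hE.le, Real.div_rpow (mul_pos hx hu1).le hE.le,
    Real.div_rpow (mul_pos hx hy).le hE.le, Real.mul_rpow hy.le hu.1.le, Real.mul_rpow hx.le hu1.le,
    Real.mul_rpow hx.le hy.le]
  simp only [Real.rpow_sub_one hE.ne', Real.rpow_sub_one hx.ne', Real.rpow_sub_one hy.ne',
    Real.rpow_add hE, Real.rpow_add hx, Real.rpow_add hy, Real.rpow_neg hx.le, Real.rpow_neg hy.le]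
  have hrpow : ∀ {z : ℝ}, 0 < z → ∀ c : ℝ, z ^ c ≠ 0 := fun hz c => (Real.rpow_pos_of_pos hz c).ne'
  have := hrpow hx a; have := hrpow hx b; have := hrpow hy a; have := hrpow hy b
  have := hrpow hE a; have := hrpow hE b
  field_simp

theorem integral_betaIntegrand_div_rpow {a b : ℝ} (ha : 0 < a) (hb : 0 < b) (hx : 0 < x)
    (hy : 0 < y) :
    ∫ t in (0 : ℝ)..1, t ^ (a - 1) * (1 - t) ^ (b - 1) / (x * t + y * (1 - t)) ^ (a + b) =
      x ^ (-a) * y ^ (-b) * beta a b := by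
  rw [← integral_comp_unitMoebius hx hy, ← integral_betaIntegrand ha hb,
    ← intervalIntegral.integral_const_mul]
  exact intervalIntegral.integral_congr_Ioo_of_le zero_le_one fun u hu =>
    betaIntegrand_div_rpow_unitMoebius a b hx hy hu

theorem integral_betaIntegrand_one_sub {a : ℝ} (h0 : 0 < a) (h1 : a < 1) :
    ∫ t in (0 : ℝ)..1, t ^ (a - 1) * (1 - t) ^ (-a) = Real.pi / Real.sin (a * Real.pi) := by
  rw [← beta_one_sub, ← integral_betaIntegrand h0 (sub_pos.2 h1), sub_sub_cancel_left]

theorem integral_betaIntegrand_one_sub_div {a : ℝ} (h0 : 0 < a) (h1 : a < 1) (hx : 0 < x)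
    (hy : 0 < y) :
    ∫ t in (0 : ℝ)..1, t ^ (a - 1) * (1 - t) ^ (-a) / (x * t + y * (1 - t)) =
      x ^ (-a) * y ^ (a - 1) * (Real.pi / Real.sin (a * Real.pi)) := by
  have h := integral_betaIntegrand_div_rpow h0 (sub_pos.2 h1) hx hy
  simpa only [sub_sub_cancel_left, add_sub_cancel, Real.rpow_one, neg_sub, beta_one_sub] using h

end BetaIntegral

section Kernel

/-- The rational functions of `t` whose average against the Jacobi weight represents
`r ^ α * s ^ (1 - α)`. -/
noncomputable def kernel (r s t : ℝ) : ℝ :=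
  r * (s - r) / (s * t + r * (1 - t))

variable {α r s t : ℝ}

theorem intervalIntegrable_betaIntegrand_one_sub_div {a : ℝ} (h0 : 0 < a) (h1 : a < 1)
    (hr : 0 < r) (hs : 0 < s) :
    IntervalIntegrable (fun t : ℝ => t ^ (a - 1) * (1 - t) ^ (-a) / (s * t + r * (1 - t)))
      volume 0 1 := by
  have h := intervalIntegrable_betaIntegrand h0 (sub_pos.2 h1)
  rw [sub_sub_cancel_left] at h
  refine h.mul_continuousOn (ContinuousOn.inv₀ (by fun_prop) fun t ht => ?_)
  rw [Set.uIcc_of_le zero_le_one] at ht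
  rw [add_comm]
  exact (segment_pos hr hs ht).ne'

theorem integral_kernel_mul_jacobiWeight_of_lt_one (h0 : 0 < α) (h1 : α < 1) (hr : 0 < r)
    (hs : 0 < s) :
    ∫ t in (0 : ℝ)..1, kernel r s t * jacobiWeight α t =
      (r ^ α * s ^ (1 - α) - r) * (Real.pi / Real.sin (α * Real.pi)) := by
  have h_split : ∀ t ∈ Set.Ioo (0 : ℝ) 1, kernel r s t * jacobiWeight α t =
      r * s * (t ^ (α - 1) * (1 - t) ^ (-α) / (s * t + r * (1 - t))) -
        r * (t ^ (α - 1) * (1 - t) ^ (-α)) := fun t ht => by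
    have hD := (segment_pos hr hs (Set.Ioo_subset_Icc_self ht)).ne'
    rw [add_comm] at hD
    rw [jacobiWeight, kernel, sub_eq_add_neg 1 α, Real.rpow_add (sub_pos.2 ht.2), Real.rpow_one]
    field_simp
    ring
  have h_int := intervalIntegrable_betaIntegrand h0 (sub_pos.2 h1)
  rw [sub_sub_cancel_left] at h_int
  rw [intervalIntegral.integral_congr_Ioo_of_le zero_le_one h_split,
    intervalIntegral.integral_sub
      ((intervalIntegrable_betaIntegrand_one_sub_div h0 h1 hr hs).const_mul _) (h_int.const_mul _),
    intervalIntegral.integral_const_mul, intervalIntegral.integral_const_mul,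
    integral_betaIntegrand_one_sub h0 h1, integral_betaIntegrand_one_sub_div h0 h1 hs hr,
    Real.rpow_sub_one hr.ne', sub_eq_add_neg 1 α, Real.rpow_add hs, Real.rpow_one]
  field_simp

theorem integral_kernel_mul_jacobiWeight_of_one_lt (h1 : 1 < α) (h2 : α < 2) (hr : 0 < r)
    (hs : 0 < s) :
    ∫ t in (0 : ℝ)..1, kernel r s t * jacobiWeight α t =
      (r ^ α * s ^ (1 - α) - r) * (Real.pi / Real.sin (α * Real.pi)) := by
  have h0' : 0 < α - 1 := sub_pos.2 h1
  have h1' : α - 1 < 1 := by linarith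
  have h_split : ∀ t ∈ Set.Ioo (0 : ℝ) 1, kernel r s t * jacobiWeight α t =
      r * (t ^ (α - 1 - 1) * (1 - t) ^ (-(α - 1))) -
        r * r * (t ^ (α - 1 - 1) * (1 - t) ^ (-(α - 1)) / (s * t + r * (1 - t))) := fun t ht => by
    have hD := (segment_pos hr hs (Set.Ioo_subset_Icc_self ht)).ne'
    rw [add_comm] at hD
    have ht0 := ht.1.ne'
    rw [jacobiWeight, kernel, Real.rpow_sub_one ht0 (α - 1), neg_sub]
    field_simp
    ring
  have h_int := intervalIntegrable_betaIntegrand h0' (sub_pos.2 h1')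
  rw [sub_sub_cancel_left] at h_int
  have h_sin : Real.sin ((α - 1) * Real.pi) = -Real.sin (α * Real.pi) := by
    rw [sub_mul, one_mul, Real.sin_sub_pi]
  rw [intervalIntegral.integral_congr_Ioo_of_le zero_le_one h_split,
    intervalIntegral.integral_sub (h_int.const_mul _)
      ((intervalIntegrable_betaIntegrand_one_sub_div h0' h1' hr hs).const_mul _),
    intervalIntegral.integral_const_mul, intervalIntegral.integral_const_mul,
    integral_betaIntegrand_one_sub h0' h1', integral_betaIntegrand_one_sub_div h0' h1' hs hr,
    h_sin, neg_sub, Real.rpow_sub_one hr.ne', Real.rpow_sub_one hr.ne']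
  field_simp
  ring

theorem sin_mul_pi_pos (h0 : 0 < α) (h1 : α < 1) : 0 < Real.sin (α * Real.pi) :=
  Real.sin_pos_of_pos_of_lt_pi (by positivity) (mul_lt_of_lt_one_left Real.pi_pos h1)

theorem sin_mul_pi_neg (h1 : 1 < α) (h2 : α < 2) : Real.sin (α * Real.pi) < 0 := by
  have h := sin_mul_pi_pos (sub_pos.2 h1) (by linarith)
  rwa [sub_mul, one_mul, Real.sin_sub_pi, neg_pos] at h

theorem rpow_mul_rpow_eq_integral_kernel (hα : α ∈ Set.Ioo (0 : ℝ) 1 ∪ Set.Ioo (1 : ℝ) 2)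
    (hr : 0 < r) (hs : 0 < s) :
    r ^ α * s ^ (1 - α) = r + Real.sin (α * Real.pi) / Real.pi *
      ∫ t in (0 : ℝ)..1, kernel r s t * jacobiWeight α t := by
  have hsin : Real.sin (α * Real.pi) ≠ 0 :=
    hα.elim (fun h => (sin_mul_pi_pos h.1 h.2).ne') (fun h => (sin_mul_pi_neg h.1 h.2).ne)
  rw [hα.elim (fun h => integral_kernel_mul_jacobiWeight_of_lt_one h.1 h.2 hr hs)
    (fun h => integral_kernel_mul_jacobiWeight_of_one_lt h.1 h.2 hr hs)]
  field_simp
  ring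

end Kernel

section Functional

open Polynomial

/-- A linear functional on polynomials is positive on `[a, b]` if it is strictly positive on nonzero
polynomials that are nonnegative there. Integration against a positive weight is the example. -/
def IsPositiveOn (Λ : ℝ[X] →ₗ[ℝ] ℝ) (a b : ℝ) : Prop :=
  ∀ p : ℝ[X], p ≠ 0 → (∀ x ∈ Set.Icc a b, 0 ≤ p.eval x) → 0 < Λ p

/-- `P` is orthogonal, for the bilinear form `(p, q) ↦ Λ (p * q)`, to all polynomials of smaller
degree. -/
def IsOrthogonalPolynomial (Λ : ℝ[X] →ₗ[ℝ] ℝ) (P : ℝ[X]) : Prop :=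
  ∀ q : ℝ[X], q.degree < P.degree → Λ (P * q) = 0

/-- The quadrature rule with nodes `t` and weights `w` reproduces `Λ` on polynomials of degree at
most `d`. -/
def IsExact {ι : Type*} [Fintype ι] (Λ : ℝ[X] →ₗ[ℝ] ℝ) (t w : ι → ℝ) (d : ℕ) : Prop :=
  ∀ p : ℝ[X], p.natDegree ≤ d → Λ p = ∑ i, w i * p.eval (t i)

variable {Λ : ℝ[X] →ₗ[ℝ] ℝ} {a b : ℝ}

theorem IsPositiveOn.comp_mulLeft (hΛ : IsPositiveOn Λ a b) {g : ℝ[X]} (hg : g ≠ 0)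
    (hg_nonneg : ∀ x ∈ Set.Icc a b, 0 ≤ g.eval x) :
    IsPositiveOn (Λ ∘ₗ LinearMap.mulLeft ℝ g) a b := fun p hp hp_nonneg =>
  hΛ (g * p) (mul_ne_zero hg hp) fun x hx => by
    rw [eval_mul]
    exact mul_nonneg (hg_nonneg x hx) (hp_nonneg x hx)

theorem IsPositiveOn.exists_monic_isOrthogonalPolynomial (hΛ : IsPositiveOn Λ a b) (n : ℕ) :
    ∃ P : ℝ[X], P.Monic ∧ P.natDegree = n ∧ IsOrthogonalPolynomial Λ P := by
  have : FiniteDimensional ℝ (degreeLT ℝ n) := Module.Finite.equiv (degreeLTEquiv ℝ n).symm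
  let B : ℝ[X] →ₗ[ℝ] ℝ[X] →ₗ[ℝ] ℝ := (LinearMap.mul ℝ ℝ[X]).compr₂ Λ
  let Φ : degreeLT ℝ n →ₗ[ℝ] Module.Dual ℝ (degreeLT ℝ n) :=
    B.domRestrict₁₂ (degreeLT ℝ n) (degreeLT ℝ n)
  have hΦ_inj : Function.Injective Φ := by
    refine (injective_iff_map_eq_zero Φ).2 fun q hq => Subtype.ext <| by_contra fun hq0 => ?_
    have hpos : 0 < Λ (q * q) := hΛ _ (mul_ne_zero hq0 hq0) fun x _ => by
      rw [eval_mul]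
      exact mul_self_nonneg _
    exact hpos.ne' (LinearMap.congr_fun hq q)
  have hΦ_surj : Function.Surjective Φ :=
    (LinearMap.injective_iff_surjective_of_finrank_eq_finrank Subspace.dual_finrank_eq.symm).1
      hΦ_inj
  obtain ⟨⟨q, hq⟩, hqX⟩ := hΦ_surj (-(B (X ^ n)).domRestrict (degreeLT ℝ n))
  rw [mem_degreeLT] at hq
  have hdeg : (X ^ n + q).degree = (n : WithBot ℕ) := by
    rw [degree_add_eq_left_of_degree_lt (by rwa [degree_X_pow]), degree_X_pow]
  refine ⟨X ^ n + q, monic_X_pow_add hq, natDegree_eq_of_degree_eq_some hdeg, fun p hp => ?_⟩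
  rw [hdeg, ← mem_degreeLT] at hp
  have hp_orth : Λ (q * p) = -Λ (X ^ n * p) := LinearMap.congr_fun hqX ⟨p, hp⟩
  rw [add_mul, map_add, hp_orth, add_neg_cancel]

namespace IsOrthogonalPolynomial

variable {P : ℝ[X]}

theorem exists_eval_neg_of_dvd (hP : IsOrthogonalPolynomial Λ P) (hΛ : IsPositiveOn Λ a b)
    (hP0 : P ≠ 0) {g : ℝ[X]} (hg : g ∣ P) (hg_deg : 0 < g.degree) :
    ∃ x ∈ Set.Icc a b, g.eval x < 0 := by
  by_contra! hg_nonneg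
  obtain ⟨Q, rfl⟩ := hg
  have hQ0 : Q ≠ 0 := right_ne_zero_of_mul hP0
  refine (hΛ _ (mul_ne_zero hP0 hQ0) fun x hx => ?_).ne' (hP Q ?_)
  · rw [mul_assoc, eval_mul, eval_mul]
    exact mul_nonneg (hg_nonneg x hx) (mul_self_nonneg _)
  · rw [degree_mul, degree_eq_natDegree hQ0,
      degree_eq_natDegree (left_ne_zero_of_mul hP0)] at *
    norm_cast at *
    omega

theorem exists_eval_pos_of_dvd (hP : IsOrthogonalPolynomial Λ P) (hΛ : IsPositiveOn Λ a b)
    (hP0 : P ≠ 0) {g : ℝ[X]} (hg : g ∣ P) (hg_deg : 0 < g.degree) :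
    ∃ x ∈ Set.Icc a b, 0 < g.eval x := by
  simpa only [eval_neg, neg_lt_zero] using
    hP.exists_eval_neg_of_dvd hΛ hP0 (neg_dvd.2 hg) (by rwa [degree_neg])

theorem splits (hP : IsOrthogonalPolynomial Λ P) (hΛ : IsPositiveOn Λ a b) (hP0 : P ≠ 0) :
    P.Splits := by
  obtain ⟨u, hu⟩ := UniqueFactorizationMonoid.factors_prod hP0
  rw [← hu]
  refine (Splits.multisetProd fun g hg => Splits.of_degree_eq_one ?_).mul u.isUnit.splits
  have hg_irr := UniqueFactorizationMonoid.irreducible_of_factor g hg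
  have hg_dvd := UniqueFactorizationMonoid.dvd_of_mem_factors hg
  obtain ⟨x, -, hx⟩ := hP.exists_eval_neg_of_dvd hΛ hP0 hg_dvd hg_irr.degree_pos
  obtain ⟨y, -, hy⟩ := hP.exists_eval_pos_of_dvd hΛ hP0 hg_dvd hg_irr.degree_pos
  obtain ⟨z, hz⟩ := mem_range_of_exists_le_of_exists_ge g.continuous ⟨x, hx.le⟩ ⟨y, hy.le⟩
  exact degree_eq_one_of_irreducible_of_root hg_irr hz

theorem nodup_roots (hP : IsOrthogonalPolynomial Λ P) (hΛ : IsPositiveOn Λ a b) (hP0 : P ≠ 0) :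
    P.roots.Nodup := by
  refine Multiset.nodup_iff_count_le_one.2 fun x => not_lt.1 fun hx => ?_
  rw [count_roots] at hx
  obtain ⟨y, -, hy⟩ := hP.exists_eval_neg_of_dvd hΛ hP0
    ((le_rootMultiplicity_iff hP0).1 hx) (by simp)
  rw [eval_pow] at hy
  exact hy.not_ge (sq_nonneg _)

theorem lt_of_isRoot (hP : IsOrthogonalPolynomial Λ P) (hΛ : IsPositiveOn Λ a b) (hP0 : P ≠ 0)
    {x : ℝ} (hx : P.IsRoot x) : x < b := by
  obtain ⟨y, hy, hxy⟩ := hP.exists_eval_pos_of_dvd hΛ hP0 (dvd_iff_isRoot.2 hx) (by simp)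
  rw [eval_sub, eval_X, eval_C, sub_pos] at hxy
  exact hxy.trans_le hy.2

end IsOrthogonalPolynomial

theorem IsPositiveOn.exists_isOrthogonalPolynomial_prod_X_sub_C (hΛ : IsPositiveOn Λ a b) (n : ℕ) :
    ∃ S : Finset ℝ, S.card = n ∧ (∀ x ∈ S, x < b) ∧
      IsOrthogonalPolynomial Λ (∏ x ∈ S, (X - C x)) := by
  obtain ⟨P, hP_monic, hP_deg, hP⟩ := hΛ.exists_monic_isOrthogonalPolynomial n
  have hP0 := hP_monic.ne_zero
  have hP_splits := hP.splits hΛ hP0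
  refine ⟨⟨P.roots, hP.nodup_roots hΛ hP0⟩, ?_, fun x hx => ?_, ?_⟩
  · rw [Finset.card_mk, splits_iff_card_roots.1 hP_splits, hP_deg]
  · exact hP.lt_of_isRoot hΛ hP0 (isRoot_of_mem_roots hx)
  · rwa [Finset.prod_mk, ← hP_splits.eq_prod_roots_of_monic hP_monic]

section Interpolatory

variable {ι : Type*} [Fintype ι] {t w : ι → ℝ} {d : ℕ}

theorem isExact_lagrange_basis [DecidableEq ι] (ht : Function.Injective t)
    (hΛ : ∀ q, (Lagrange.nodal Finset.univ t * q).natDegree ≤ d →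
      Λ (Lagrange.nodal Finset.univ t * q) = 0) :
    IsExact Λ t (fun i => Λ (Lagrange.basis Finset.univ t i)) d := fun p hp => by
  set N := Lagrange.nodal Finset.univ t
  have hN : N.Monic := Lagrange.nodal_monic
  have hdiv : p %ₘ N + N * (p /ₘ N) = p := modByMonic_add_div p N
  have hdiv_deg : (N * (p /ₘ N)).natDegree ≤ d := by
    rw [← sub_eq_of_eq_add' hdiv.symm]
    exact (natDegree_sub_le_of_le hp (natDegree_modByMonic_le_left.trans hp)).trans (max_self d).le
  have hrem_eval : ∀ i, (p %ₘ N).eval (t i) = p.eval (t i) := fun i => by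
    conv_rhs => rw [← hdiv]
    rw [eval_add, eval_mul, Lagrange.eval_nodal_at_node (Finset.mem_univ i), zero_mul, add_zero]
  have hrem : p %ₘ N = ∑ i, C (p.eval (t i)) * Lagrange.basis Finset.univ t i := by
    rw [← Lagrange.interpolate_apply]
    refine Lagrange.eq_interpolate_of_eval_eq _ ht.injOn ?_ fun i _ => hrem_eval i
    rw [← Lagrange.degree_nodal (v := t)]
    exact degree_modByMonic_lt p hN
  rw [← hdiv, map_add, hΛ _ hdiv_deg, add_zero, hdiv, hrem, map_sum]
  refine Finset.sum_congr rfl fun i _ => ?_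
  rw [← smul_eq_C_mul, map_smul, smul_eq_mul, mul_comm]

theorem nodal_orderEmbOfFin {s : Finset ℝ} {k : ℕ} (hs : s.card = k) :
    Lagrange.nodal Finset.univ (s.orderEmbOfFin hs) = ∏ x ∈ s, (X - C x) := by
  conv_rhs => rw [← s.map_orderEmbOfFin_univ hs, Finset.prod_map]
  rfl

theorem exists_gaussRadau (hΛ : IsPositiveOn Λ a b) (n : ℕ) :
    ∃ t w : Fin (n + 1) → ℝ, StrictMono t ∧ t (Fin.last n) = b ∧ IsExact Λ t w (2 * n) := by
  have hΛb : IsPositiveOn (Λ ∘ₗ LinearMap.mulLeft ℝ (C b - X)) a b :=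
    hΛ.comp_mulLeft (sub_ne_zero_of_ne (X_ne_C b).symm) fun x hx => by simpa using hx.2
  obtain ⟨S, hS_card, hS_lt, hS_orth⟩ := hΛb.exists_isOrthogonalPolynomial_prod_X_sub_C n
  have hbS : b ∉ S := fun h => (hS_lt b h).false
  have hcard : (insert b S).card = n + 1 := by rw [Finset.card_insert_of_notMem hbS, hS_card]
  have h_nodal : Lagrange.nodal Finset.univ ((insert b S).orderEmbOfFin hcard) =
      (X - C b) * ∏ x ∈ S, (X - C x) := by
    rw [nodal_orderEmbOfFin, Finset.prod_insert hbS]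
  have hP0 : ∏ x ∈ S, (X - C x) ≠ 0 := (monic_prod_X_sub_C _ S).ne_zero
  have hP_deg : (∏ x ∈ S, (X - C x)).natDegree = n := by
    rw [natDegree_finsetProd_X_sub_C_eq_card, hS_card]
  refine ⟨(insert b S).orderEmbOfFin hcard, _, OrderEmbedding.strictMono _, ?_,
    isExact_lagrange_basis (RelEmbedding.injective _) fun q hq => ?_⟩
  · refine (Finset.orderEmbOfFin_last hcard n.succ_pos).trans <|
      (Finset.isGreatest_max' _ _).unique ⟨Finset.mem_insert_self b S, fun x hx => ?_⟩
    exact (Finset.mem_insert.1 hx).elim le_of_eq fun h => (hS_lt x h).le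
  · rw [h_nodal, mul_assoc] at hq ⊢
    rcases eq_or_ne q 0 with rfl | hq0
    · rw [mul_zero, mul_zero, map_zero]
    · rw [natDegree_mul (X_sub_C_ne_zero b) (mul_ne_zero hP0 hq0), natDegree_mul hP0 hq0,
        natDegree_X_sub_C, hP_deg] at hq
      rw [← neg_sub, neg_mul, map_neg, neg_eq_zero]
      exact hS_orth q (degree_lt_degree (by omega))

theorem IsExact.eval_pos_of_forall_ne (hexact : IsExact Λ t w d) (hΛ : IsPositiveOn Λ a b)
    {p : ℝ[X]} (hp : p ≠ 0) (hp_deg : p.natDegree ≤ d)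
    (hp_nonneg : ∀ x ∈ Set.Icc a b, 0 ≤ p.eval x) {i : ι} (hp_zero : ∀ j ≠ i, p.eval (t j) = 0) :
    0 < w i * p.eval (t i) := by
  have h_pos := hΛ p hp hp_nonneg
  rwa [hexact p hp_deg, Fintype.sum_eq_single i fun j hj => by rw [hp_zero j hj, mul_zero]]
    at h_pos

theorem IsExact.weight_pos (hexact : IsExact Λ t w d) (hΛ : IsPositiveOn Λ a b)
    (hd : 2 * (Fintype.card ι - 1) ≤ d) (i : ι) : 0 < w i := by
  classical
  let N := Lagrange.nodal (Finset.univ.erase i) t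
  have hN_zero : ∀ j ≠ i, N.eval (t j) = 0 := fun j hj =>
    Lagrange.eval_nodal_at_node (Finset.mem_erase.2 ⟨hj, Finset.mem_univ j⟩)
  have h_eval : ∀ x, (N ^ 2).eval x = N.eval x ^ 2 := fun x => eval_pow 2
  have h_pos := hexact.eval_pos_of_forall_ne hΛ (p := N ^ 2) (i := i)
    (pow_ne_zero 2 Lagrange.nodal_ne_zero) ?_ (fun x _ => ?_) fun j hj => ?_
  · rw [h_eval] at h_pos
    exact pos_of_mul_pos_left h_pos (sq_nonneg _)
  · rwa [natDegree_pow, Lagrange.natDegree_nodal, Finset.card_erase_of_mem (Finset.mem_univ i),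
      Finset.card_univ]
  · rw [h_eval]
    exact sq_nonneg _
  · rw [h_eval, hN_zero j hj, zero_pow two_ne_zero]

theorem natDegree_X_sub_C_mul_C_sub_X_mul_sq_le (a b : ℝ) (M : ℝ[X]) :
    ((X - C a) * (C b - X) * M ^ 2).natDegree ≤ 2 * M.natDegree + 2 := by
  have h_lin : (C b - X : ℝ[X]).natDegree = 1 := by
    rw [← neg_sub, natDegree_neg, natDegree_X_sub_C]
  refine natDegree_mul_le.trans ((Nat.add_le_add_right natDegree_mul_le _).trans ?_)
  rw [natDegree_X_sub_C, h_lin, natDegree_pow]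
  omega

theorem IsExact.node_mem_Ioo (hexact : IsExact Λ t w d) (hΛ : IsPositiveOn Λ a b) (hab : a ≤ b)
    (hd : 2 * (Fintype.card ι - 1) ≤ d) {i₀ i : ι} (ht : t i₀ = b) (hi : i ≠ i₀) :
    t i ∈ Set.Ioo a b := by
  classical
  let M := Lagrange.nodal ((Finset.univ.erase i₀).erase i) t
  have hi_mem : i ∈ Finset.univ.erase i₀ := Finset.mem_erase.2 ⟨hi, Finset.mem_univ i⟩
  have hM_zero : ∀ j ≠ i, j ≠ i₀ → M.eval (t j) = 0 := fun j hj hj₀ =>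
    Lagrange.eval_nodal_at_node
      (Finset.mem_erase.2 ⟨hj, Finset.mem_erase.2 ⟨hj₀, Finset.mem_univ j⟩⟩)
  have h_eval : ∀ x, ((X - C a) * (C b - X) * M ^ 2).eval x = (x - a) * (b - x) * M.eval x ^ 2 :=
    fun x => by simp
  have h_pos := hexact.eval_pos_of_forall_ne hΛ (p := (X - C a) * (C b - X) * M ^ 2) (i := i)
    ?_ ?_ (fun x hx => ?_) fun j hj => ?_
  · rw [h_eval] at h_pos
    have h_prod : 0 < (t i - a) * (b - t i) :=
      pos_of_mul_pos_left (pos_of_mul_pos_right h_pos (hexact.weight_pos hΛ hd i).le) (sq_nonneg _)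
    rcases pos_and_pos_or_neg_and_neg_of_mul_pos h_prod with h | h
    · exact ⟨sub_pos.1 h.1, sub_pos.1 h.2⟩
    · linarith [h.1, h.2]
  · exact mul_ne_zero (mul_ne_zero (X_sub_C_ne_zero a) (sub_ne_zero_of_ne (X_ne_C b).symm))
      (pow_ne_zero 2 Lagrange.nodal_ne_zero)
  · have h_card : 1 < Fintype.card ι := Fintype.one_lt_card_iff.2 ⟨i, i₀, hi⟩
    have hM_deg : M.natDegree = Fintype.card ι - 1 - 1 := by
      rw [Lagrange.natDegree_nodal, Finset.card_erase_of_mem hi_mem,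
        Finset.card_erase_of_mem (Finset.mem_univ i₀), Finset.card_univ]
    have h_deg := natDegree_X_sub_C_mul_C_sub_X_mul_sq_le a b M
    omega
  · rw [h_eval]
    exact mul_nonneg (mul_nonneg (sub_nonneg.2 hx.1) (sub_nonneg.2 hx.2)) (sq_nonneg _)
  · rw [h_eval]
    rcases eq_or_ne j i₀ with rfl | hj₀
    · rw [ht, sub_self, mul_zero, zero_mul]
    · rw [hM_zero j hj hj₀, zero_pow two_ne_zero, mul_zero]

theorem exists_eval_eq_inv_sub_sub_div {q : ℝ[X]} {c : ℝ} (hq : q.eval c ≠ 0) :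
    ∃ p : ℝ[X], p.natDegree = q.natDegree - 1 ∧
      ∀ x ≠ c, (x - c)⁻¹ - p.eval x = q.eval x / (q.eval c * (x - c)) := by
  refine ⟨-(C (q.eval c)⁻¹ * (q /ₘ (X - C c))), ?_, fun x hx => ?_⟩
  · rw [natDegree_neg, natDegree_C_mul (inv_ne_zero hq), natDegree_divByMonic _ (monic_X_sub_C c),
      natDegree_X_sub_C]
  · have h_div := congrArg (eval x) (modByMonic_add_div q (X - C c))
    simp only [modByMonic_X_sub_C_eq_C_eval, eval_add, eval_mul, eval_sub, eval_X, eval_C] at h_div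
    have := sub_ne_zero.2 hx
    rw [eval_neg, eval_mul, eval_C, ← h_div]
    field_simp
    ring

theorem exists_eval_le_inv_sub (ht_mem : ∀ i, t i ∈ Set.Icc a b) {i₀ : ι} (ht : t i₀ = b) {c : ℝ}
    (hc : c ∉ Set.Icc a b) :
    ∃ p : ℝ[X], p.natDegree ≤ 2 * (Fintype.card ι - 1) ∧ (∀ i, p.eval (t i) = (t i - c)⁻¹) ∧
      ∀ x ∈ Set.Icc a b, p.eval x ≤ (x - c)⁻¹ := by
  classical
  let N := Lagrange.nodal (Finset.univ.erase i₀) t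
  have hne : ∀ x ∈ Set.Icc a b, x ≠ c := fun x hx => ne_of_mem_of_not_mem hx hc
  have hNc : N.eval c ≠ 0 := Lagrange.eval_nodal_not_at_node fun i _ => (hne _ (ht_mem i)).symm
  have hq_eval : ∀ x, ((X - C b) * N ^ 2).eval x = (x - b) * N.eval x ^ 2 := fun x => by simp
  have hq_node : ∀ i, ((X - C b) * N ^ 2).eval (t i) = 0 := fun i => by
    rw [hq_eval]
    rcases eq_or_ne i i₀ with rfl | hi
    · rw [ht, sub_self, zero_mul]
    · rw [Lagrange.eval_nodal_at_node (Finset.mem_erase.2 ⟨hi, Finset.mem_univ i⟩),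
        zero_pow two_ne_zero, mul_zero]
  have hbc : c - b ≠ 0 := sub_ne_zero.2 (hne b (ht ▸ ht_mem i₀)).symm
  obtain ⟨p, hp_deg, hp⟩ := exists_eval_eq_inv_sub_sub_div (q := (X - C b) * N ^ 2) (c := c) <| by
    rw [hq_eval]
    exact mul_ne_zero hbc (pow_ne_zero 2 hNc)
  refine ⟨p, ?_, fun i => ?_, fun x hx => sub_nonneg.1 ?_⟩
  · rw [hp_deg, natDegree_mul (X_sub_C_ne_zero b) (pow_ne_zero 2 Lagrange.nodal_ne_zero),
      natDegree_X_sub_C, natDegree_pow, Lagrange.natDegree_nodal,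
      Finset.card_erase_of_mem (Finset.mem_univ i₀), Finset.card_univ, add_tsub_cancel_left]
  · have h := hp (t i) (hne _ (ht_mem i))
    rw [hq_node, zero_div] at h
    exact (sub_eq_zero.1 h).symm
  · have h_sign : 0 ≤ (x - b) / ((c - b) * (x - c)) := by
      have hxb : x - b ≤ 0 := sub_nonpos.2 hx.2
      rw [Set.mem_Icc, not_and_or, not_le, not_le] at hc
      refine div_nonneg_of_nonpos hxb (hc.elim (fun h => ?_) fun h => ?_)
      · exact mul_nonpos_of_nonpos_of_nonneg (by linarith [hx.1]) (by linarith [hx.1])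
      · exact mul_nonpos_of_nonneg_of_nonpos (by linarith) (by linarith)
    rw [hp x (hne x hx), hq_eval, hq_eval, mul_right_comm, mul_div_mul_comm, ← div_pow]
    exact mul_nonneg h_sign (sq_nonneg _)

end Interpolatory

end Functional

section Weight

open Polynomial

variable {v : ℝ → ℝ} {a b : ℝ}

theorem intervalIntegrable_eval_mul (hv : IntervalIntegrable v volume a b) (p : ℝ[X]) :
    IntervalIntegrable (fun x => p.eval x * v x) volume a b :=
  hv.continuousOn_mul p.continuousOn

/-- Integration of polynomials against the weight function `v` on `[a, b]`. -/
noncomputable def weightFunctional (hv : IntervalIntegrable v volume a b) : ℝ[X] →ₗ[ℝ] ℝ where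
  toFun p := ∫ x in a..b, p.eval x * v x
  map_add' p q := by
    simp only [eval_add, add_mul]
    exact intervalIntegral.integral_add (intervalIntegrable_eval_mul hv p)
      (intervalIntegrable_eval_mul hv q)
  map_smul' c p := by
    simp only [eval_smul, smul_eq_mul, mul_assoc, intervalIntegral.integral_const_mul,
      RingHom.id_apply]

theorem isPositiveOn_weightFunctional (hab : a < b) (hv : IntervalIntegrable v volume a b)
    (hv_pos : ∀ x ∈ Set.Ioo a b, 0 < v x) : IsPositiveOn (weightFunctional hv) a b := by
  intro p hp hp_nonneg
  have h_ae_Ioo : ∀ᵐ x ∂volume.restrict (Set.uIoc a b), x ∈ Set.Ioo a b := by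
    rw [Set.uIoc_of_le hab.le, ← restrict_Ioo_eq_restrict_Ioc]
    exact ae_restrict_mem measurableSet_Ioo
  have h_nonneg : 0 ≤ᵐ[volume.restrict (Set.uIoc a b)] fun x => p.eval x * v x := by
    filter_upwards [h_ae_Ioo] with x hx
    exact mul_nonneg (hp_nonneg x (Set.Ioo_subset_Icc_self hx)) (hv_pos x hx).le
  have h_support : Set.Ioo a b \ (p.roots.toFinset : Set ℝ) ⊆
      (Function.support fun x => p.eval x * v x) ∩ Set.Ioc a b := by
    rintro x ⟨hx, hx_root⟩
    refine ⟨mul_ne_zero (fun h => hx_root ?_) (hv_pos x hx).ne', Set.Ioo_subset_Ioc_self hx⟩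
    rw [Finset.mem_coe, Multiset.mem_toFinset]
    exact (mem_roots hp).2 h
  refine (intervalIntegral.integral_pos_iff_support_of_nonneg_ae' h_nonneg
    (intervalIntegrable_eval_mul hv p)).2 ⟨hab, (measure_mono h_support).trans_lt' ?_⟩
  rw [measure_sdiff_null (p.roots.toFinset.finite_toSet.measure_zero volume), Real.volume_Ioo]
  exact ENNReal.ofReal_pos.2 (sub_pos.2 hab)

theorem integral_mul_le_integral_mul (hab : a ≤ b) (hv : IntervalIntegrable v volume a b)
    (hv_nonneg : ∀ x ∈ Set.Ioo a b, 0 ≤ v x) {f g : ℝ → ℝ} (hf : ContinuousOn f (Set.Icc a b))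
    (hg : ContinuousOn g (Set.Icc a b)) (hfg : ∀ x ∈ Set.Icc a b, f x ≤ g x) :
    ∫ x in a..b, f x * v x ≤ ∫ x in a..b, g x * v x := by
  rw [← Set.uIcc_of_le hab] at hf hg
  exact intervalIntegral.integral_mono_on_of_le_Ioo hab (hv.continuousOn_mul hf)
    (hv.continuousOn_mul hg) fun x hx =>
      mul_le_mul_of_nonneg_right (hfg x (Set.Ioo_subset_Icc_self hx)) (hv_nonneg x hx)

variable {ι : Type*} [Fintype ι] {t w : ι → ℝ} {d : ℕ} {hv : IntervalIntegrable v volume a b}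

theorem IsExact.sum_weight_eq_integral (hexact : IsExact (weightFunctional hv) t w d) :
    ∑ i, w i = ∫ x in a..b, v x := by
  have h := hexact 1 (by simp)
  simp only [weightFunctional, LinearMap.coe_mk, AddHom.coe_mk, eval_one, one_mul, mul_one] at h
  exact h.symm

theorem IsExact.sum_inv_sub_le_integral (hexact : IsExact (weightFunctional hv) t w d)
    (hab : a ≤ b) (hv_nonneg : ∀ x ∈ Set.Ioo a b, 0 ≤ v x) (hd : 2 * (Fintype.card ι - 1) ≤ d)
    (ht_mem : ∀ i, t i ∈ Set.Icc a b) {i₀ : ι} (ht : t i₀ = b) {c : ℝ} (hc : c ∉ Set.Icc a b) :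
    ∑ i, w i * (t i - c)⁻¹ ≤ ∫ x in a..b, (x - c)⁻¹ * v x := by
  obtain ⟨p, hp_deg, hp_node, hp_le⟩ := exists_eval_le_inv_sub ht_mem ht hc
  calc ∑ i, w i * (t i - c)⁻¹ = ∑ i, w i * p.eval (t i) := by simp only [hp_node]
    _ = ∫ x in a..b, p.eval x * v x := (hexact p (hp_deg.trans hd)).symm
    _ ≤ ∫ x in a..b, (x - c)⁻¹ * v x :=
      integral_mul_le_integral_mul hab hv hv_nonneg p.continuousOn
        (ContinuousOn.inv₀ (by fun_prop) fun x hx => sub_ne_zero.2 (ne_of_mem_of_not_mem hx hc))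
        hp_le

theorem abs_integral_mul_sub_integral_mul_le (hab : a ≤ b) (hv : IntervalIntegrable v volume a b)
    (hv_nonneg : ∀ x ∈ Set.Ioo a b, 0 ≤ v x) {f g : ℝ → ℝ} (hf : ContinuousOn f (Set.Icc a b))
    (hg : ContinuousOn g (Set.Icc a b)) {ε : ℝ} (hfg : ∀ x ∈ Set.Icc a b, |f x - g x| ≤ ε) :
    |(∫ x in a..b, f x * v x) - ∫ x in a..b, g x * v x| ≤ ε * ∫ x in a..b, v x := by
  have hf_int := hv.continuousOn_mul ((Set.uIcc_of_le hab).symm ▸ hf)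
  have hg_int := hv.continuousOn_mul ((Set.uIcc_of_le hab).symm ▸ hg)
  rw [← intervalIntegral.integral_sub hf_int hg_int, ← intervalIntegral.integral_const_mul]
  refine (intervalIntegral.abs_integral_le_integral_abs hab).trans <|
    intervalIntegral.integral_mono_on_of_le_Ioo hab (hf_int.sub hg_int).abs (hv.const_mul ε)
      fun x hx => ?_
  rw [← sub_mul, abs_mul, abs_of_nonneg (hv_nonneg x hx)]
  exact mul_le_mul_of_nonneg_right (hfg x (Set.Ioo_subset_Icc_self hx)) (hv_nonneg x hx)

theorem abs_sum_mul_sub_sum_mul_le (hw : ∀ i, 0 ≤ w i) {f g : ℝ → ℝ} {ε : ℝ}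
    (hfg : ∀ i, |f (t i) - g (t i)| ≤ ε) :
    |∑ i, w i * f (t i) - ∑ i, w i * g (t i)| ≤ ε * ∑ i, w i := by
  rw [← Finset.sum_sub_distrib, Finset.mul_sum]
  refine (Finset.abs_sum_le_sum_abs _ _).trans (Finset.sum_le_sum fun i _ => ?_)
  rw [← mul_sub, abs_mul, abs_of_nonneg (hw i), mul_comm]
  exact mul_le_mul_of_nonneg_right (hfg i) (hw i)

theorem IsExact.abs_sum_sub_integral_le (hexact : IsExact (weightFunctional hv) t w d)
    (hab : a ≤ b) (hv_nonneg : ∀ x ∈ Set.Ioo a b, 0 ≤ v x) (ht_mem : ∀ i, t i ∈ Set.Icc a b)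
    (hw : ∀ i, 0 ≤ w i) {f : ℝ → ℝ} (hf : ContinuousOn f (Set.Icc a b)) {p : ℝ[X]}
    (hp_deg : p.natDegree ≤ d) {ε : ℝ} (hp : ∀ x ∈ Set.Icc a b, |p.eval x - f x| ≤ ε) :
    |∑ i, w i * f (t i) - ∫ x in a..b, f x * v x| ≤ 2 * ε * ∫ x in a..b, v x := by
  have h_sum : |∑ i, w i * f (t i) - ∑ i, w i * p.eval (t i)| ≤ ε * ∑ i, w i :=
    abs_sum_mul_sub_sum_mul_le (g := fun x => p.eval x) hw fun i => by
      rw [abs_sub_comm]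
      exact hp _ (ht_mem i)
  have h_int := abs_integral_mul_sub_integral_mul_le hab hv hv_nonneg p.continuousOn hf hp
  have h_exact : ∫ x in a..b, p.eval x * v x = ∑ i, w i * p.eval (t i) := hexact p hp_deg
  rw [hexact.sum_weight_eq_integral] at h_sum
  rw [h_exact] at h_int
  linarith [abs_sub_le (∑ i, w i * f (t i)) (∑ i, w i * p.eval (t i)) (∫ x in a..b, f x * v x)]

theorem tendsto_sum_of_isExact {β : Type*} {l : Filter β} {ι : β → Type*} [∀ m, Fintype (ι m)]
    {t w : ∀ m, ι m → ℝ} {d : β → ℕ} (hd : Tendsto d l atTop) (hab : a ≤ b)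
    (hv_nonneg : ∀ x ∈ Set.Ioo a b, 0 ≤ v x)
    (h : ∀ᶠ m in l, IsExact (weightFunctional hv) (t m) (w m) (d m) ∧
      ∀ i, t m i ∈ Set.Icc a b ∧ 0 ≤ w m i)
    {f : ℝ → ℝ} (hf : ContinuousOn f (Set.Icc a b)) :
    Tendsto (fun m => ∑ i, w m i * f (t m i)) l (𝓝 (∫ x in a..b, f x * v x)) := by
  have hV : 0 ≤ ∫ x in a..b, v x := by
    simpa using integral_mul_le_integral_mul hab hv hv_nonneg continuousOn_const
      continuousOn_const fun _ _ => zero_le_one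
  set V := ∫ x in a..b, v x
  refine Metric.tendsto_nhds.2 fun ε hε => ?_
  obtain ⟨p, hp⟩ := exists_polynomial_near_of_continuousOn a b f hf (ε / (2 * (V + 1)))
    (by positivity)
  filter_upwards [h, hd.eventually_ge_atTop p.natDegree] with m ⟨hexact, hm⟩ hp_deg
  calc |∑ i, w m i * f (t m i) - ∫ x in a..b, f x * v x|
      ≤ 2 * (ε / (2 * (V + 1))) * V := hexact.abs_sum_sub_integral_le hab hv_nonneg
        (fun i => (hm i).1) (fun i => (hm i).2) hf hp_deg fun x hx => (hp x hx).le
    _ = ε * (V / (V + 1)) := by field_simp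
    _ < ε := mul_lt_of_lt_one_right hε ((div_lt_one (by positivity)).2 (lt_add_one V))

end Weight

section Jacobi

variable {α : ℝ}

theorem intervalIntegrable_jacobiWeight (h0 : 0 < α) (h2 : α < 2) :
    IntervalIntegrable (jacobiWeight α) volume 0 1 := by
  have h := intervalIntegrable_betaIntegrand h0 (sub_pos.2 h2)
  rwa [show 2 - α - 1 = 1 - α by ring] at h

theorem jacobiWeight_pos (α : ℝ) {u : ℝ} (hu : u ∈ Set.Ioo (0 : ℝ) 1) : 0 < jacobiWeight α u :=
  mul_pos (Real.rpow_pos_of_pos hu.1 _) (Real.rpow_pos_of_pos (sub_pos.2 hu.2) _)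

theorem isPositiveOn_jacobiFunctional (h0 : 0 < α) (h2 : α < 2) :
    IsPositiveOn (weightFunctional (intervalIntegrable_jacobiWeight h0 h2)) 0 1 :=
  isPositiveOn_weightFunctional zero_lt_one _ fun _ => jacobiWeight_pos α

theorem exists_isGaussRadauJacobi (h0 : 0 < α) (h2 : α < 2) {m : ℕ} (hm : 1 ≤ m) :
    ∃ t w : Fin m → ℝ, IsGaussRadauJacobi α m t w := by
  obtain ⟨n, rfl⟩ := Nat.exists_eq_add_of_le' hm
  obtain ⟨t, w, ht_mono, ht_last, hexact⟩ :=
    exists_gaussRadau (isPositiveOn_jacobiFunctional h0 h2) n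
  refine ⟨t, w, ht_mono, fun i hi => ?_, fun p hp => hexact p (by omega)⟩
  rwa [Fin.ext (a := i) (b := Fin.last n) (Nat.succ_injective hi)]

namespace IsGaussRadauJacobi

variable {m : ℕ} {t w : Fin m → ℝ}

theorem isExact (h : IsGaussRadauJacobi α m t w) (hm : 1 ≤ m) (h0 : 0 < α) (h2 : α < 2) :
    IsExact (weightFunctional (intervalIntegrable_jacobiWeight h0 h2)) t w (2 * (m - 1)) :=
  fun p hp => h.exact p (by omega)

theorem weight_pos (h : IsGaussRadauJacobi α m t w) (h0 : 0 < α) (h2 : α < 2) (i : Fin m) :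
    0 < w i :=
  (h.isExact i.pos h0 h2).weight_pos (isPositiveOn_jacobiFunctional h0 h2)
    (by rw [Fintype.card_fin]) i

theorem exists_node_eq_one (h : IsGaussRadauJacobi α m t w) (hm : 1 ≤ m) : ∃ i, t i = 1 :=
  ⟨⟨m - 1, by omega⟩, h.last_node _ (Nat.sub_add_cancel hm)⟩

theorem node_mem (h : IsGaussRadauJacobi α m t w) (h0 : 0 < α) (h2 : α < 2) (i : Fin m) :
    t i ∈ Set.Ioc (0 : ℝ) 1 := by
  obtain ⟨i₀, hi₀⟩ := h.exists_node_eq_one i.pos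
  rcases eq_or_ne i i₀ with rfl | hi
  · rw [hi₀]
    exact Set.right_mem_Ioc.2 zero_lt_one
  · exact Set.Ioo_subset_Ioc_self <| (h.isExact i.pos h0 h2).node_mem_Ioo
      (isPositiveOn_jacobiFunctional h0 h2) zero_le_one (by rw [Fintype.card_fin]) hi₀ hi

theorem sum_kernel_le_integral (h : IsGaussRadauJacobi α m t w) (hm : 1 ≤ m) (h0 : 0 < α)
    (h2 : α < 2) {r s : ℝ} (hr : 0 < r) (hs : 0 < s) :
    ∑ i, w i * kernel r s (t i) ≤ ∫ u in (0 : ℝ)..1, kernel r s u * jacobiWeight α u := by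
  rcases eq_or_ne s r with rfl | hrs
  · simp [kernel]
  obtain ⟨i₀, hi₀⟩ := h.exists_node_eq_one hm
  have h_kernel : ∀ u, kernel r s u = r * (u - r / (r - s))⁻¹ := fun u => by
    rw [kernel, mul_div_assoc, ← inv_div]
    congr 2
    field_simp [sub_ne_zero.2 hrs, sub_ne_zero.2 hrs.symm]
    ring
  have h_pole : r / (r - s) ∉ Set.Icc (0 : ℝ) 1 := fun hc => by
    refine (segment_pos hr hs hc).ne' ?_
    field_simp [sub_ne_zero.2 hrs.symm]
    ring
  simp only [h_kernel, mul_left_comm (w _), mul_assoc, ← Finset.mul_sum,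
    intervalIntegral.integral_const_mul]
  exact mul_le_mul_of_nonneg_left ((h.isExact hm h0 h2).sum_inv_sub_le_integral zero_le_one
    (fun _ hu => (jacobiWeight_pos α hu).le) (by rw [Fintype.card_fin])
    (fun i => Set.Ioc_subset_Icc_self (h.node_mem h0 h2 i)) hi₀ h_pole) hr.le

end IsGaussRadauJacobi

theorem continuousOn_kernel {r s : ℝ} (hr : 0 < r) (hs : 0 < s) :
    ContinuousOn (kernel r s) (Set.Icc 0 1) :=
  ContinuousOn.div (by fun_prop) (by fun_prop) fun u hu => by
    rw [add_comm]
    exact (segment_pos hr hs hu).ne'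

theorem tendsto_sum_kernel (h0 : 0 < α) (h2 : α < 2) {t w : (m : ℕ) → Fin m → ℝ}
    (h : ∀ m, 1 ≤ m → IsGaussRadauJacobi α m (t m) (w m)) {r s : ℝ} (hr : 0 < r) (hs : 0 < s) :
    Tendsto (fun m => ∑ i, w m i * kernel r s (t m i)) atTop
      (𝓝 (∫ u in (0 : ℝ)..1, kernel r s u * jacobiWeight α u)) := by
  have h_deg : Tendsto (fun m => 2 * (m - 1)) atTop atTop :=
    (tendsto_sub_atTop_nat 1).const_mul_atTop' two_pos
  refine tendsto_sum_of_isExact (hv := intervalIntegrable_jacobiWeight h0 h2) h_deg zero_le_one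
    (fun _ hu => (jacobiWeight_pos α hu).le) ?_ (continuousOn_kernel hr hs)
  filter_upwards [eventually_ge_atTop 1] with m hm
  exact ⟨(h m hm).isExact hm h0 h2, fun i =>
    ⟨Set.Ioc_subset_Icc_self ((h m hm).node_mem h0 h2 i), ((h m hm).weight_pos h0 h2 i).le⟩⟩

end Jacobi

section FunctionalCalculus

variable {H : Type*} [NormedAddCommGroup H] [InnerProductSpace ℂ H]

theorem finite_real_spectrum [FiniteDimensional ℂ H] (a : H →L[ℂ] H) :
    (spectrum ℝ a).Finite := by
  have h : (spectrum ℂ a).Finite := by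
    rw [← AlgEquiv.spectrum_eq (Module.End.toContinuousLinearMap H).symm a]
    exact Module.End.finite_spectrum _
  exact (h.preimage (FaithfulSMul.algebraMap_injective ℝ ℂ).injOn).subset fun x hx =>
    (spectrum.algebraMap_mem_iff ℂ).2 hx

theorem aeval_apply_of_apply_eq_smul {a : H →L[ℂ] H} {v : H} {x : ℝ} (hv : a v = (x : ℂ) • v)
    (p : Polynomial ℝ) : Polynomial.aeval a p v = ((p.eval x : ℝ) : ℂ) • v := by
  induction p using Polynomial.induction_on with
  | C c => simp [Algebra.algebraMap_eq_smul_one]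
  | add p q hp hq => rw [map_add, add_apply, hp, hq, Polynomial.eval_add, Complex.ofReal_add,
      add_smul]
  | monomial n c ih =>
    rw [pow_succ, ← mul_assoc, map_mul, Polynomial.aeval_X, mul_apply_eq_comp, hv, map_smul, ih,
      smul_smul, Polynomial.eval_mul_X, Complex.ofReal_mul, mul_comm]

variable [CompleteSpace H] [FiniteDimensional ℂ H]

theorem cfc_apply_of_apply_eq_smul {a : H →L[ℂ] H} (ha : IsSelfAdjoint a) {v : H} {x : ℝ}
    (hv : a v = (x : ℂ) • v) (f : ℝ → ℝ) : cfc f a v = ((f x : ℝ) : ℂ) • v := by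
  classical
  let S : Finset ℝ := insert x (finite_real_spectrum a).toFinset
  let p : Polynomial ℝ := Lagrange.interpolate S id f
  have hp : ∀ y ∈ S, p.eval y = f y := fun y hy =>
    Lagrange.eval_interpolate_at_node f (v := id) (Set.injOn_id _) hy
  have hp_cfc : cfc f a = Polynomial.aeval a p := by
    rw [← cfc_polynomial p a ha]
    refine cfc_congr fun y hy => (hp y ?_).symm
    exact Finset.mem_insert_of_mem ((finite_real_spectrum a).mem_toFinset.2 hy)
  rw [hp_cfc, aeval_apply_of_apply_eq_smul hv, hp x (Finset.mem_insert_self _ _)]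

theorem rpow_apply_of_apply_eq_smul {a : H →L[ℂ] H} (ha : a.IsPositive) {v : H} {x : ℝ}
    (hv : a v = (x : ℂ) • v) (s : ℝ) : (a ^ s) v = ((x ^ s : ℝ) : ℂ) • v := by
  rw [CFC.rpow_eq_cfc_real ((ContinuousLinearMap.nonneg_iff_isPositive a).2 ha)]
  exact cfc_apply_of_apply_eq_smul ha.isSelfAdjoint hv _

end FunctionalCalculus

section Trace

variable {H : Type*} [NormedAddCommGroup H] [InnerProductSpace ℂ H] {ι κ : Type*} [Fintype ι]
  [Fintype κ]

/-- `e` is an orthonormal basis of eigenvectors of `a`, and `r` lists the eigenvalues, which are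
real. -/
def IsEigenbasis (a : H →L[ℂ] H) (e : OrthonormalBasis ι ℂ H) (r : ι → ℝ) : Prop :=
  ∀ j, a (e j) = (r j : ℂ) • e j

theorem exists_isEigenbasis [FiniteDimensional ℂ H] {a : H →L[ℂ] H} (ha : a.IsSymmetric) :
    ∃ (e : OrthonormalBasis (Fin (Module.finrank ℂ H)) ℂ H) (r : Fin (Module.finrank ℂ H) → ℝ),
      IsEigenbasis a e r :=
  ⟨ha.eigenvectorBasis rfl, ha.eigenvalues rfl, ha.apply_eigenvectorBasis rfl⟩

variable {a b : H →L[ℂ] H} {e : OrthonormalBasis ι ℂ H} {f : OrthonormalBasis κ ℂ H} {r : ι → ℝ}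
  {s : κ → ℝ}

theorem isEigenbasis_one (e : OrthonormalBasis ι ℂ H) : IsEigenbasis 1 e 1 := fun j => by simp

theorem IsEigenbasis.nonneg (he : IsEigenbasis a e r) (ha : a.IsPositive) (j : ι) : 0 ≤ r j := by
  have h := ha.re_inner_nonneg_left (e j)
  rw [he j, inner_smul_left, inner_self_eq_norm_sq_to_K, e.orthonormal.norm_eq_one] at h
  simpa using h

theorem IsEigenbasis.rpow [CompleteSpace H] (he : IsEigenbasis a e r) (ha : a.IsPositive) (p : ℝ) :
    IsEigenbasis (a ^ p) e fun j => r j ^ p := fun j =>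
  have := e.toBasis.finiteDimensional_of_finite
  rpow_apply_of_apply_eq_smul ha (he j) p

theorem tr_add (A B : H →L[ℂ] H) : tr (A + B) = tr A + tr B := by
  simp only [tr, ContinuousLinearMap.toLinearMap_add, map_add, Complex.add_re]

theorem tr_ofReal_smul (c : ℝ) (A : H →L[ℂ] H) : tr ((c : ℂ) • A) = c * tr A := by
  simp only [tr, ContinuousLinearMap.toLinearMap_smul, map_smul, smul_eq_mul, Complex.re_ofReal_mul]

theorem IsEigenbasis.tr_mul (he : IsEigenbasis a e r) (A : H →L[ℂ] H) :
    tr (a * A) = ∑ j, r j * (inner ℂ (e j) (A (e j))).re := by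
  have h_comm : tr (a * A) = tr (A * a) := congrArg Complex.re (LinearMap.trace_mul_comm ℂ _ _)
  rw [h_comm, tr, LinearMap.trace_eq_sum_inner _ e, Complex.re_sum]
  refine Finset.sum_congr rfl fun j _ => ?_
  rw [ContinuousLinearMap.coe_coe, mul_apply_eq_comp, he j, map_smul, inner_smul_right,
    Complex.re_ofReal_mul]

theorem IsEigenbasis.re_inner_apply (he : IsEigenbasis a e r) (v : H) :
    (inner ℂ v (a v)).re = ∑ j, r j * ‖inner ℂ (e j) v‖ ^ 2 := by
  have h_apply : a v = ∑ j, inner ℂ (e j) v • (r j : ℂ) • e j := by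
    conv_lhs => rw [← e.sum_repr' v, map_sum]
    simp only [map_smul, he _]
  rw [h_apply, inner_sum, Complex.re_sum]
  refine Finset.sum_congr rfl fun j _ => ?_
  rw [inner_smul_right, inner_smul_right, mul_left_comm, Complex.re_ofReal_mul,
    ← inner_conj_symm v (e j), Complex.mul_conj, Complex.ofReal_re, Complex.normSq_eq_norm_sq]

theorem IsEigenbasis.tr_mul_eq_sum_sum (he : IsEigenbasis a e r) (hf : IsEigenbasis b f s) :
    tr (a * b) = ∑ j, ∑ k, r j * s k * ‖inner ℂ (e j) (f k)‖ ^ 2 := by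
  simp only [he.tr_mul, hf.re_inner_apply, Finset.mul_sum, mul_assoc, norm_inner_symm (f _)]

theorem exists_inner_apply_eq (e : OrthonormalBasis ι ℂ H) (f : OrthonormalBasis κ ℂ H)
    (z : ι → κ → ℂ) : ∃ Z : H →L[ℂ] H, ∀ j k, inner ℂ (f k) (Z (e j)) = z j k := by
  have := e.toBasis.finiteDimensional_of_finite
  refine ⟨LinearMap.toContinuousLinearMap (e.toBasis.constr ℂ fun j => ∑ k, z j k • f k),
    fun j k => ?_⟩
  rw [LinearMap.coe_toContinuousLinearMap', ← e.coe_toBasis, Module.Basis.constr_basis,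
    f.orthonormal.inner_right_fintype]

variable [CompleteSpace H]

theorem IsEigenbasis.tr_mul_add_star (he : IsEigenbasis a e r) (f : OrthonormalBasis κ ℂ H)
    (Z : H →L[ℂ] H) :
    tr (a * (Z + star Z)) =
      ∑ j, ∑ k, 2 * (r j * inner ℂ (e j) (f k) * inner ℂ (f k) (Z (e j))).re := by
  have h_star : ∀ j, (inner ℂ (e j) (star Z (e j))).re = (inner ℂ (e j) (Z (e j))).re := fun j => by
    rw [ContinuousLinearMap.star_eq_adjoint, ContinuousLinearMap.adjoint_inner_right,
      ← inner_conj_symm, Complex.conj_re]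
  rw [he.tr_mul]
  refine Finset.sum_congr rfl fun j _ => ?_
  simp only [← Finset.mul_sum, ← Complex.re_sum, mul_assoc, f.sum_inner_mul_inner]
  rw [add_apply, inner_add_right, Complex.add_re, h_star, Complex.re_ofReal_mul]
  ring

theorem IsEigenbasis.tr_mul_star_mul_self (he : IsEigenbasis a e r) (f : OrthonormalBasis κ ℂ H)
    (Z : H →L[ℂ] H) :
    tr (a * (star Z * Z)) = ∑ j, ∑ k, r j * ‖inner ℂ (f k) (Z (e j))‖ ^ 2 := by
  rw [he.tr_mul]
  refine Finset.sum_congr rfl fun j _ => ?_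
  rw [← Finset.mul_sum, f.sum_sq_norm_inner_right, mul_apply_eq_comp,
    ContinuousLinearMap.star_eq_adjoint, ContinuousLinearMap.adjoint_inner_right,
    inner_self_eq_norm_sq_to_K]
  norm_cast

end Trace

section SpectralSum

variable {H : Type*} [NormedAddCommGroup H] [InnerProductSpace ℂ H] {ι κ : Type*} [Fintype ι]
  [Fintype κ]

/-- The sum of `F` over the pairs of positive eigenvalues of two operators, each pair weighted by
the overlap of its eigenvectors (the Nussbaum–Szkoła distributions). Traces of products of functions
of the two operators are of this form. -/
noncomputable def spectralSum (e : OrthonormalBasis ι ℂ H) (f : OrthonormalBasis κ ℂ H)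
    (r : ι → ℝ) (s : κ → ℝ) : (ℝ → ℝ → ℝ) →ₗ[ℝ] ℝ where
  toFun F := ∑ p : ι × κ with 0 < r p.1 ∧ 0 < s p.2,
    F (r p.1) (s p.2) * ‖inner ℂ (e p.1) (f p.2)‖ ^ 2
  map_add' F G := by simp only [Pi.add_apply, add_mul, Finset.sum_add_distrib]
  map_smul' c F := by
    simp only [Pi.smul_apply, smul_eq_mul, mul_assoc, ← Finset.mul_sum, RingHom.id_apply]

section

variable (e : OrthonormalBasis ι ℂ H) (f : OrthonormalBasis κ ℂ H) (r : ι → ℝ) (s : κ → ℝ)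
  {F G : ℝ → ℝ → ℝ}

theorem spectralSum_mono (hFG : ∀ x y, 0 < x → 0 < y → F x y ≤ G x y) :
    spectralSum e f r s F ≤ spectralSum e f r s G :=
  Finset.sum_le_sum fun _ hp => mul_le_mul_of_nonneg_right
    (hFG _ _ (Finset.mem_filter.1 hp).2.1 (Finset.mem_filter.1 hp).2.2) (sq_nonneg _)

theorem spectralSum_congr (hFG : ∀ x y, 0 < x → 0 < y → F x y = G x y) :
    spectralSum e f r s F = spectralSum e f r s G :=
  le_antisymm (spectralSum_mono e f r s fun x y hx hy => (hFG x y hx hy).le)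
    (spectralSum_mono e f r s fun x y hx hy => (hFG x y hx hy).ge)

theorem tendsto_spectralSum {β : Type*} {l : Filter β} {F : β → ℝ → ℝ → ℝ}
    (hFG : ∀ x y, 0 < x → 0 < y → Tendsto (fun m => F m x y) l (𝓝 (G x y))) :
    Tendsto (fun m => spectralSum e f r s (F m)) l (𝓝 (spectralSum e f r s G)) :=
  tendsto_finsetSum _ fun _ hp =>
    (hFG _ _ (Finset.mem_filter.1 hp).2.1 (Finset.mem_filter.1 hp).2.2).mul_const _

end

variable {ρ σ : H →L[ℂ] H} {e : OrthonormalBasis ι ℂ H} {f : OrthonormalBasis κ ℂ H} {r : ι → ℝ}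
  {s : κ → ℝ}

theorem Dominated.mul_inner_eq_zero (hdom : Dominated ρ σ) (hρ : ρ.IsSymmetric)
    (he : IsEigenbasis ρ e r) (hf : IsEigenbasis σ f s) {j : ι} {k : κ} (hk : s k = 0) :
    r j * inner ℂ (e j) (f k) = 0 := by
  have hρ_f : ρ (f k) = 0 := hdom _ (by rw [hf k, hk, Complex.ofReal_zero, zero_smul])
  have h := hρ (e j) (f k)
  rwa [ContinuousLinearMap.coe_coe, hρ_f, inner_zero_right, he j, inner_smul_left,
    Complex.conj_ofReal] at h

theorem sum_sum_eq_spectralSum (hρ : ρ.IsPositive) (hσ : σ.IsPositive) (hdom : Dominated ρ σ)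
    (he : IsEigenbasis ρ e r) (hf : IsEigenbasis σ f s) {F : ℝ → ℝ → ℝ} (hF : ∀ y, F 0 y = 0) :
    ∑ j, ∑ k, F (r j) (s k) * ‖inner ℂ (e j) (f k)‖ ^ 2 = spectralSum e f r s F := by
  rw [← Fintype.sum_prod_type']
  refine (Finset.sum_filter_of_ne fun p _ hp => ?_).symm
  have hr : r p.1 ≠ 0 := fun h => hp (by rw [h, hF, zero_mul])
  have h_inner : inner ℂ (e p.1) (f p.2) ≠ 0 := fun h => hp (by simp [h])
  have hs : s p.2 ≠ 0 := fun h =>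
    mul_ne_zero (Complex.ofReal_ne_zero.2 hr) h_inner
      (hdom.mul_inner_eq_zero hρ.isSymmetric he hf h)
  exact ⟨(he.nonneg hρ _).lt_of_ne' hr, (hf.nonneg hσ _).lt_of_ne' hs⟩

theorem tr_eq_spectralSum (hρ : ρ.IsPositive) (hσ : σ.IsPositive) (hdom : Dominated ρ σ)
    (he : IsEigenbasis ρ e r) (hf : IsEigenbasis σ f s) :
    tr ρ = spectralSum e f r s fun x _ => x := by
  rw [← sum_sum_eq_spectralSum hρ hσ hdom he hf fun _ => rfl]
  simpa using he.tr_mul_eq_sum_sum (isEigenbasis_one f)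

variable [CompleteSpace H]

theorem petzTrace_eq_spectralSum {α : ℝ} (hα : α ≠ 0) (hρ : ρ.IsPositive) (hσ : σ.IsPositive)
    (hdom : Dominated ρ σ) (he : IsEigenbasis ρ e r) (hf : IsEigenbasis σ f s) :
    petzTrace α ρ σ = spectralSum e f r s fun x y => x ^ α * y ^ (1 - α) := by
  rw [← sum_sum_eq_spectralSum hρ hσ hdom he hf fun y => by rw [Real.zero_rpow hα, zero_mul]]
  exact (he.rpow hρ α).tr_mul_eq_sum_sum (hf.rpow hσ (1 - α))

end SpectralSum

section Objective

theorem two_mul_re_add_mul_sq_norm {D : ℝ} {v : ℂ} (hv : D = 0 → v = 0) (z : ℂ) :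
    2 * (v * z).re + D * ‖z‖ ^ 2 =
      D * ‖z + starRingEnd ℂ v / D‖ ^ 2 - ‖v‖ ^ 2 / D := by
  rcases eq_or_ne D 0 with rfl | hD
  · simp [hv rfl]
  · have h_re : (z * (v / D)).re = (v * z).re / D := by
      rw [mul_comm v, ← mul_div_assoc, Complex.div_ofReal_re]
    rw [Complex.sq_norm, Complex.sq_norm, Complex.sq_norm, Complex.normSq_add,
      map_div₀ (starRingEnd ℂ), Complex.conj_conj, Complex.conj_ofReal, h_re, Complex.normSq_div,
      Complex.normSq_conj, Complex.normSq_ofReal]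
    field_simp
    ring

variable {H : Type*} [NormedAddCommGroup H] [InnerProductSpace ℂ H] [CompleteSpace H]
  {ι κ : Type*} [Fintype ι] [Fintype κ] {ρ σ : H →L[ℂ] H} {e : OrthonormalBasis ι ℂ H}
  {f : OrthonormalBasis κ ℂ H} {r : ι → ℝ} {s : κ → ℝ} {t : ℝ}

theorem objective_eq_sum (he : IsEigenbasis ρ e r) (hf : IsEigenbasis σ f s) (t : ℝ)
    (Z : H →L[ℂ] H) :
    objective ρ σ t Z = ∑ j, ∑ k,
      (2 * (r j * inner ℂ (e j) (f k) * inner ℂ (f k) (Z (e j))).re +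
        (s k * t + r j * (1 - t)) * ‖inner ℂ (f k) (Z (e j))‖ ^ 2) := by
  have h_adjoint : ∀ j k, ‖inner ℂ (e j) (star Z (f k))‖ = ‖inner ℂ (f k) (Z (e j))‖ :=
    fun j k => by
      rw [ContinuousLinearMap.star_eq_adjoint, ContinuousLinearMap.adjoint_inner_right,
        norm_inner_symm]
  have hσ_sum : tr (σ * (Z * star Z)) = ∑ j, ∑ k, s k * ‖inner ℂ (f k) (Z (e j))‖ ^ 2 := by
    have h := hf.tr_mul_star_mul_self e (star Z)
    rw [star_star, Finset.sum_comm] at h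
    simpa only [h_adjoint] using h
  rw [objective, mul_add, mul_smul_comm, tr_add, tr_ofReal_smul, he.tr_mul_add_star f,
    he.tr_mul_star_mul_self f, hσ_sum]
  simp only [Finset.mul_sum, ← Finset.sum_add_distrib]
  refine Finset.sum_congr rfl fun j _ => Finset.sum_congr rfl fun k _ => ?_
  ring

theorem objective_eq_sum_sub_spectralSum (hρ : ρ.IsPositive) (hσ : σ.IsPositive)
    (hdom : Dominated ρ σ) (he : IsEigenbasis ρ e r) (hf : IsEigenbasis σ f s)
    (ht : t ∈ Set.Ioc (0 : ℝ) 1) (Z : H →L[ℂ] H) :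
    objective ρ σ t Z =
      ∑ j, ∑ k, (s k * t + r j * (1 - t)) * ‖inner ℂ (f k) (Z (e j)) +
          starRingEnd ℂ (r j * inner ℂ (e j) (f k)) / (s k * t + r j * (1 - t) : ℝ)‖ ^ 2 -
        spectralSum e f r s fun x y => x ^ 2 / (y * t + x * (1 - t)) := by
  have h_zero : ∀ j k, s k * t + r j * (1 - t) = 0 → r j * inner ℂ (e j) (f k) = 0 := by
    intro j k hD
    have hs_zero : s k * t = 0 := by
      linarith [mul_nonneg (hf.nonneg hσ k) ht.1.le,
        mul_nonneg (he.nonneg hρ j) (sub_nonneg.2 ht.2)]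
    exact hdom.mul_inner_eq_zero hρ.isSymmetric he hf
      ((mul_eq_zero.1 hs_zero).resolve_right ht.1.ne')
  rw [objective_eq_sum he hf, ← sum_sum_eq_spectralSum hρ hσ hdom he hf (fun _ => by simp)]
  simp only [← Finset.sum_sub_distrib]
  refine Finset.sum_congr rfl fun j _ => Finset.sum_congr rfl fun k _ => ?_
  rw [two_mul_re_add_mul_sq_norm (h_zero j k), norm_mul, mul_pow, Complex.norm_real,
    Real.norm_eq_abs, sq_abs, div_mul_eq_mul_div]

theorem isLeast_range_objective (hρ : ρ.IsPositive) (hσ : σ.IsPositive) (hdom : Dominated ρ σ)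
    (he : IsEigenbasis ρ e r) (hf : IsEigenbasis σ f s) (ht : t ∈ Set.Ioc (0 : ℝ) 1) :
    IsLeast (Set.range (objective ρ σ t))
      (-spectralSum e f r s fun x y => x ^ 2 / (y * t + x * (1 - t))) := by
  constructor
  · obtain ⟨Z, hZ⟩ := exists_inner_apply_eq e f fun j k =>
      -(starRingEnd ℂ (r j * inner ℂ (e j) (f k)) / (s k * t + r j * (1 - t) : ℝ))
    exact ⟨Z, by simp [objective_eq_sum_sub_spectralSum hρ hσ hdom he hf ht, hZ]⟩
  · rintro _ ⟨Z, rfl⟩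
    rw [objective_eq_sum_sub_spectralSum hρ hσ hdom he hf ht, neg_le_sub_iff_le_add,
      le_add_iff_nonneg_left]
    have hD : ∀ j k, 0 ≤ s k * t + r j * (1 - t) := fun j k =>
      add_nonneg (mul_nonneg (hf.nonneg hσ k) ht.1.le)
        (mul_nonneg (he.nonneg hρ j) (sub_nonneg.2 ht.2))
    exact Finset.sum_nonneg fun j _ => Finset.sum_nonneg fun k _ =>
      mul_nonneg (hD j k) (sq_nonneg _)

theorem tr_add_iInf_objective (hρ : ρ.IsPositive) (hσ : σ.IsPositive) (hdom : Dominated ρ σ)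
    (he : IsEigenbasis ρ e r) (hf : IsEigenbasis σ f s) (ht : t ∈ Set.Ioc (0 : ℝ) 1) :
    tr ρ + ⨅ Z, objective ρ σ t Z = spectralSum e f r s fun x y => t * kernel x y t := by
  rw [iInf, (isLeast_range_objective hρ hσ hdom he hf ht).csInf_eq,
    tr_eq_spectralSum hρ hσ hdom he hf, ← sub_eq_add_neg, ← map_sub]
  refine spectralSum_congr e f r s fun x y hx hy => ?_
  have hD := (segment_pos hx hy (Set.Ioc_subset_Icc_self ht)).ne'
  rw [add_comm] at hD
  rw [Pi.sub_apply, Pi.sub_apply, kernel]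
  field_simp
  ring

theorem quadratureBound_eq_spectralSum (α : ℝ) (hρ : ρ.IsPositive) (hσ : σ.IsPositive)
    (hdom : Dominated ρ σ) (he : IsEigenbasis ρ e r) (hf : IsEigenbasis σ f s) {m : ℕ}
    {t w : Fin m → ℝ} (ht : ∀ i, t i ∈ Set.Ioc (0 : ℝ) 1) :
    quadratureBound α t w ρ σ = spectralSum e f r s fun x y =>
      x + Real.sin (α * Real.pi) / Real.pi * ∑ i, w i * kernel x y (t i) := by
  set c := Real.sin (α * Real.pi) / Real.pi with hc
  calc quadratureBound α t w ρ σ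
      = tr ρ + c * ∑ i, w i / t i * (tr ρ + ⨅ Z, objective ρ σ (t i) Z) := by
        simp only [quadratureBound, ← hc, mul_add, Finset.sum_add_distrib, ← Finset.sum_mul]
        ring
    _ = spectralSum e f r s ((fun x _ => x) +
          c • ∑ i, (w i / t i) • fun x y => t i * kernel x y (t i)) := by
        simp only [map_add, map_smul, map_sum, smul_eq_mul, ← tr_eq_spectralSum hρ hσ hdom he hf,
          ← tr_add_iInf_objective hρ hσ hdom he hf (ht _)]
    _ = _ := spectralSum_congr e f r s fun x y _ _ => by
        simp only [Pi.add_apply, Pi.smul_apply, Finset.sum_apply, smul_eq_mul, ← mul_assoc,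
          div_mul_cancel₀ _ (ht _).1.ne']

end Objective

section Bounds

variable {H : Type*} [NormedAddCommGroup H] [InnerProductSpace ℂ H] [CompleteSpace H]
  [FiniteDimensional ℂ H] {ρ σ : H →L[ℂ] H} {α : ℝ}

theorem bddBelow_range_objective (hρ : ρ.IsPositive) (hσ : σ.IsPositive) (hdom : Dominated ρ σ)
    {t : ℝ} (ht : t ∈ Set.Ioc (0 : ℝ) 1) : BddBelow (Set.range (objective ρ σ t)) := by
  obtain ⟨e, r, he⟩ := exists_isEigenbasis hρ.isSymmetric
  obtain ⟨f, s, hf⟩ := exists_isEigenbasis hσ.isSymmetric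
  exact ⟨_, (isLeast_range_objective hρ hσ hdom he hf ht).2⟩

theorem IsGaussRadauJacobi.quadratureBound_le_petzTrace {m : ℕ} {t w : Fin m → ℝ}
    (h : IsGaussRadauJacobi α m t w) (hm : 1 ≤ m) (h0 : 0 < α) (h1 : α < 1) (hρ : ρ.IsPositive)
    (hσ : σ.IsPositive) (hdom : Dominated ρ σ) :
    quadratureBound α t w ρ σ ≤ petzTrace α ρ σ := by
  have h2 : α < 2 := h1.trans one_lt_two
  obtain ⟨e, r, he⟩ := exists_isEigenbasis hρ.isSymmetric
  obtain ⟨f, s, hf⟩ := exists_isEigenbasis hσ.isSymmetric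
  rw [petzTrace_eq_spectralSum h0.ne' hρ hσ hdom he hf,
    quadratureBound_eq_spectralSum α hρ hσ hdom he hf (h.node_mem h0 h2)]
  refine spectralSum_mono e f r s fun x y hx hy => ?_
  rw [rpow_mul_rpow_eq_integral_kernel (Or.inl ⟨h0, h1⟩) hx hy]
  exact add_le_add_right (mul_le_mul_of_nonneg_left (h.sum_kernel_le_integral hm h0 h2 hx hy)
    (div_pos (sin_mul_pi_pos h0 h1) Real.pi_pos).le) x

theorem IsGaussRadauJacobi.petzTrace_le_quadratureBound {m : ℕ} {t w : Fin m → ℝ}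
    (h : IsGaussRadauJacobi α m t w) (hm : 1 ≤ m) (h1 : 1 < α) (h2 : α < 2) (hρ : ρ.IsPositive)
    (hσ : σ.IsPositive) (hdom : Dominated ρ σ) :
    petzTrace α ρ σ ≤ quadratureBound α t w ρ σ := by
  have h0 : 0 < α := one_pos.trans h1
  obtain ⟨e, r, he⟩ := exists_isEigenbasis hρ.isSymmetric
  obtain ⟨f, s, hf⟩ := exists_isEigenbasis hσ.isSymmetric
  rw [petzTrace_eq_spectralSum h0.ne' hρ hσ hdom he hf,
    quadratureBound_eq_spectralSum α hρ hσ hdom he hf (h.node_mem h0 h2)]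
  refine spectralSum_mono e f r s fun x y hx hy => ?_
  rw [rpow_mul_rpow_eq_integral_kernel (Or.inr ⟨h1, h2⟩) hx hy]
  exact add_le_add_right (mul_le_mul_of_nonpos_left (h.sum_kernel_le_integral hm h0 h2 hx hy)
    (div_neg_of_neg_of_pos (sin_mul_pi_neg h1 h2) Real.pi_pos).le) x

theorem tendsto_quadratureBound (hα : α ∈ Set.Ioo (0 : ℝ) 1 ∪ Set.Ioo (1 : ℝ) 2)
    {t w : (m : ℕ) → Fin m → ℝ} (h : ∀ m, 1 ≤ m → IsGaussRadauJacobi α m (t m) (w m))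
    (hρ : ρ.IsPositive) (hσ : σ.IsPositive) (hdom : Dominated ρ σ) :
    Tendsto (fun m => quadratureBound α (t m) (w m) ρ σ) atTop (𝓝 (petzTrace α ρ σ)) := by
  have h0 : 0 < α := hα.elim (fun h => h.1) fun h => zero_lt_one.trans h.1
  have h2 : α < 2 := hα.elim (fun h => h.2.trans one_lt_two) fun h => h.2
  obtain ⟨e, r, he⟩ := exists_isEigenbasis hρ.isSymmetric
  obtain ⟨f, s, hf⟩ := exists_isEigenbasis hσ.isSymmetric
  rw [petzTrace_eq_spectralSum h0.ne' hρ hσ hdom he hf]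
  have h_bound : (fun m => quadratureBound α (t m) (w m) ρ σ) =ᶠ[atTop] fun m =>
      spectralSum e f r s fun x y =>
        x + Real.sin (α * Real.pi) / Real.pi * ∑ i, w m i * kernel x y (t m i) := by
    filter_upwards [eventually_ge_atTop 1] with m hm
    exact quadratureBound_eq_spectralSum α hρ hσ hdom he hf ((h m hm).node_mem h0 h2)
  refine (tendsto_spectralSum e f r s fun x y hx hy => ?_).congr' h_bound.symm
  rw [rpow_mul_rpow_eq_integral_kernel hα hx hy]
  exact ((tendsto_sum_kernel h0 h2 h hx hy).const_mul _).const_add x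

end Bounds

end PetzRenyi

theorem theorem3 (α : ℝ) (hα : α ∈ Set.Ioo (0 : ℝ) 1 ∪ Set.Ioo (1 : ℝ) 2) :
    -- For every `m ≥ 1` the quadrature rule exists.
    (∀ m : ℕ, 1 ≤ m → ∃ t w : Fin m → ℝ, PetzRenyi.IsGaussRadauJacobi α m t w) ∧
    -- However the rules are given, they have the following properties.
    ∀ t w : (m : ℕ) → Fin m → ℝ,
      (∀ m : ℕ, 1 ≤ m → PetzRenyi.IsGaussRadauJacobi α m (t m) (w m)) →
      (∀ m : ℕ, 1 ≤ m → ∀ i : Fin m, t m i ∈ Set.Ioc (0 : ℝ) 1 ∧ 0 < w m i) ∧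
      ∀ (H : Type*) [NormedAddCommGroup H] [InnerProductSpace ℂ H] [CompleteSpace H]
        [FiniteDimensional ℂ H] (ρ σ : H →L[ℂ] H),
        ρ.IsPositive → σ.IsPositive → PetzRenyi.Dominated ρ σ →
        -- All the infima are finite.
        (∀ m : ℕ, 1 ≤ m → ∀ i : Fin m,
          BddBelow (Set.range (PetzRenyi.objective ρ σ (t m i)))) ∧
        -- Lower bound for `α < 1`, upper bound for `α > 1`.
        (α < 1 → ∀ m : ℕ, 1 ≤ m →
          PetzRenyi.quadratureBound α (t m) (w m) ρ σ ≤ PetzRenyi.petzTrace α ρ σ) ∧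
        (1 < α → ∀ m : ℕ, 1 ≤ m →
          PetzRenyi.petzTrace α ρ σ ≤ PetzRenyi.quadratureBound α (t m) (w m) ρ σ) ∧
        -- Convergence of the bounds.
        Tendsto (fun m : ℕ => PetzRenyi.quadratureBound α (t m) (w m) ρ σ) atTop
          (𝓝 (PetzRenyi.petzTrace α ρ σ)) := by
  have h0 : 0 < α := hα.elim (fun h => h.1) fun h => zero_lt_one.trans h.1
  have h2 : α < 2 := hα.elim (fun h => h.2.trans one_lt_two) fun h => h.2
  refine ⟨fun m hm => PetzRenyi.exists_isGaussRadauJacobi h0 h2 hm, fun t w h => ?_⟩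
  refine ⟨fun m hm i => ⟨(h m hm).node_mem h0 h2 i, (h m hm).weight_pos h0 h2 i⟩, ?_⟩
  intro H _ _ _ _ ρ σ hρ hσ hdom
  exact ⟨fun m hm i => PetzRenyi.bddBelow_range_objective hρ hσ hdom ((h m hm).node_mem h0 h2 i),
    fun h1 m hm => (h m hm).quadratureBound_le_petzTrace hm h0 h1 hρ hσ hdom,
    fun h1 m hm => (h m hm).petzTrace_le_quadratureBound hm h1 h2 hρ hσ hdom,
    PetzRenyi.tendsto_quadratureBound hα h hρ hσ hdom⟩
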